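/- Let $(\mathcal C,\otimes,I)$ be a small symmetric monoidal category, $\mathrm{ob}\,\mathcal A$ a collection of objects, and $J:\mathrm{ob}\,\mathcal A\to\mathrm{ob}\,\mathcal C$ a mapping on objects. Let $\widehat{\mathcal C}=[\mathcal C^{\mathrm{op}},\mathbf{Set}]$ carry its closed monoidal structure given by Day convolution $\widehat\otimes$, with unit $\widehat I\cong\mathcal C(-,I)$, and regard $\widehat{\mathcal C}$ as enriched in itself. Enrich $\mathcal C$ in $\widehat{\mathcal C}$ fully faithfully along the Yoneda embedding $\mathsf y:\mathcal C\to\widehat{\mathcal C}$, that is, $\mathcal C[X,Y]$ is the internal hom from $\mathsf yX$ to $\mathsf yY$, with the identities and composition $\bullet$ of $\widehat{\mathcal C}$; thus $\mathcal C[X,Y](\Gamma)\cong\mathcal C(\Gamma\otimes X,Y)$, naturally in $\Gamma$. A *$\widehat{\mathcal C}$-enriched $J$-relative monad* $(T,\eta,(-)^*)$ consists of objects $TA$ of $\mathcal C$, morphisms $\eta_A:\widehat I\to\mathcal C[JA,TA]$ and morphisms $*:\mathcal C[JA,TB]\to\mathcal C[TA,TB]$ in $\widehat{\mathcal C}$,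 for $A,B\in\mathrm{ob}\,\mathcal A$, such that $*\circ\eta_A=\mathbf{id}_{TA}$, $\bullet\circ(*\,\widehat\otimes\,\eta_A)=\rho$ and $\bullet\circ(*\,\widehat\otimes\,*)=*\circ\bullet\circ(*\,\widehat\otimes\,\mathrm{id})$. A morphism $(T,\eta,(-)^*)\to(S,\nu,(-)^\dagger)$ is a family $\gamma_A:\widehat I\to\mathcal C[TA,SA]$ such that composing $\eta_A$ with $\gamma_A$ gives $\nu_A$ and such that, as morphisms $\mathcal C[JA,TB]\to\mathcal C[TA,SB]$, the extension $*$ followed by postcomposition with $\gamma_B$ equals postcomposition with $\gamma_B$, followed by $\dagger$, followed by precomposition with $\gamma_A$. A *strong $J$-relative monad* $(T,\eta,(-)^*)$ consists of objects $TA$, morphisms $\eta_A:JA\to TA$ and maps $(-)^*:\mathcal C(\Gamma\otimes JA,TB)\to\mathcal C(\Gamma\otimes TA,TB)$ natural in $\Gamma\in\mathcal C$, such that for all $f:\Gamma\otimes JA\to TB$ and $g:\Delta\otimes JB\to TC$ $$(\eta_A\circ\lambda_{JA})^*=\lambda_{TA},\qquad f^*\circ(\Gamma\otimes\eta_A)=f,\qquad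 g^*\circ(\Delta\otimes f^*)\circ\alpha_{\Delta,\Gamma,TA}=\bigl(g^*\circ(\Delta\otimes f)\circ\alpha_{\Delta,\Gamma,JA}\bigr)^*.$$ A morphism $(T,\eta,(-)^*)\to(S,\nu,(-)^\dagger)$ is a family $\gamma_A:TA\to SA$ with $\nu_A=\gamma_A\circ\eta_A$ and $\gamma_B\circ f^*=(\gamma_B\circ f)^\dagger\circ(\Gamma\otimes\gamma_A)$ for all $f:\Gamma\otimes JA\to TB$. Then there is an isomorphism of categories from the category of $\widehat{\mathcal C}$-enriched $J$-relative monads to the category of strong $J$-relative monads. It can be chosen to keep the objects $TA$, and to act on units, on extensions and on morphisms through the bijections $\mathcal C[X,Y](\Gamma)\cong\mathcal C(\Gamma\otimes X,Y)$ and the resulting $\widehat{\mathcal C}(\widehat I,\mathcal C[X,Y])\cong\mathcal C(X,Y)$. -/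

import Mathlib

open CategoryTheory MonoidalCategory Opposite
open scoped CategoryTheory.MonoidalCategory.DayFunctor CategoryTheory.MonoidalCategory.ExternalProduct
universe w u

/- Erased so that `X ⟶ Y` elaborates through `CategoryStruct.toQuiver`, as it does in Mathlib. -/
attribute [-instance] CategoryTheory.catToReflQuiver

noncomputable section
/-! Closedness of the Day convolution monoidal structure on functors `D ⥤ Type u`.  Presheaves on
`C` are the case `D = Cᵒᵖ`. -/

namespace DayPresheaf

variable {D : Type u} [SmallCategory D] [MonoidalCategory D]

/-- The internal hom for Day convolution: `(F ⊸ G)(X)` is the set of natural transformations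
`F ⟶ G(- ⊗ X)`. -/
def ihomObj (F G : D ⊛⥤ Type u) : D ⊛⥤ Type u where
  functor :=
    { obj X := F.functor ⟶ tensorRight X ⋙ G.functor
      map {X Y} f := ↾fun t =>
        { app := fun Z => t.app Z ≫ G.functor.map (Z ◁ f)
          naturality := by
            intro Z W g
            have := t.naturality g
            dsimp at this ⊢
            rw [reassoc_of% this, Category.assoc, ← Functor.map_comp, ← Functor.map_comp,
              whisker_exchange] }
      map_id X := by
        ext t Z a
        change G.functor.map (Z ◁ 𝟙 X) (t.app Z a) = t.app Z a
        rw [MonoidalCategory.whiskerLeft_id]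
        exact ConcreteCategory.congr_hom (G.functor.map_id _) _
      map_comp {X Y Z} f g := by
        ext t W a
        change G.functor.map (W ◁ (f ≫ g)) (t.app W a) =
          G.functor.map (W ◁ g) (G.functor.map (W ◁ f) (t.app W a))
        rw [MonoidalCategory.whiskerLeft_comp]
        exact ConcreteCategory.congr_hom (G.functor.map_comp _ _) _ }

lemma ihomObj_ext {F G : D ⊛⥤ Type u} {X : D} {s t : (ihomObj F G).functor.obj X}
    (h : ∀ (Z : D) (a : F.functor.obj Z),
      NatTrans.app (F := F.functor) (G := tensorRight X ⋙ G.functor) s Z a =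
        NatTrans.app (F := F.functor) (G := tensorRight X ⋙ G.functor) t Z a) : s = t :=
  NatTrans.ext (funext fun Z => by ext a; exact h Z a)

/-- An element of the external product `F ⊠ H` at `(X, Y)`. -/
def pair {F H : D ⊛⥤ Type u} {X Y : D} (a : F.functor.obj X) (b : H.functor.obj Y) :
    (F.functor ⊠ H.functor).obj (X, Y) :=
  (show F.functor.obj X × H.functor.obj Y from (a, b))

/-- The element of the Day convolution `F ⊗ H` at `X ⊗ Y` represented by a pair of elements. -/
def tmul {F H : D ⊛⥤ Type u} {X Y : D} (a : F.functor.obj X) (b : H.functor.obj Y) :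
    (F ⊗ H).functor.obj (X ⊗ Y) :=
  (DayFunctor.η F H).app (X, Y) (pair a b)

lemma map_tmul {F H : D ⊛⥤ Type u} {X X' Y Y' : D} (f : X ⟶ X') (g : Y ⟶ Y')
    (a : F.functor.obj X) (b : H.functor.obj Y) :
    (F ⊗ H).functor.map (f ⊗ₘ g) (tmul a b) = tmul (F.functor.map f a) (H.functor.map g b) :=
  (ConcreteCategory.congr_hom (C := Type u)
    ((DayFunctor.η F H).naturality (X := (X, Y)) (Y := (X', Y')) (f, g))
    (pair (F := F) (H := H) a b)).symm

lemma map_whiskerRight_tmul {F H : D ⊛⥤ Type u} {X X' : D} (f : X ⟶ X') (Y : D)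
    (a : F.functor.obj X) (b : H.functor.obj Y) :
    (F ⊗ H).functor.map (f ▷ Y) (tmul a b) = tmul (F.functor.map f a) b := by
  have h := map_tmul f (𝟙 Y) a b
  rw [tensorHom_id] at h
  rw [h]
  exact congrArg _ (ConcreteCategory.congr_hom (H.functor.map_id Y) b)

lemma map_whiskerLeft_tmul {F H : D ⊛⥤ Type u} (X : D) {Y Y' : D} (g : Y ⟶ Y')
    (a : F.functor.obj X) (b : H.functor.obj Y) :
    (F ⊗ H).functor.map (X ◁ g) (tmul a b) = tmul a (H.functor.map g b) := by
  have h := map_tmul (𝟙 X) g a b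
  rw [id_tensorHom] at h
  rw [h]
  exact congrArg (tmul · _) (ConcreteCategory.congr_hom (F.functor.map_id X) a)

lemma whiskerLeft_tmul (F : D ⊛⥤ Type u) {H H' : D ⊛⥤ Type u} (g : H ⟶ H') {X Y : D}
    (a : F.functor.obj X) (b : H.functor.obj Y) :
    (F ◁ g).natTrans.app (X ⊗ Y) (tmul a b) = tmul a (g.natTrans.app Y b) :=
  ConcreteCategory.congr_hom (C := Type u)
    (LawfulDayConvolutionMonoidalCategoryStruct.convolutionExtensionUnit_comp_ι_map_whiskerLeft_app
      (C := D) (Type u) F g X Y) (pair (F := F) (H := H) a b)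

/-- Currying of a morphism out of a Day convolution. -/
def curryHom {F H G : D ⊛⥤ Type u} (t : F ⊗ H ⟶ G) : H ⟶ ihomObj F G where
  natTrans :=
    { app := fun X => ↾fun b =>
        { app := fun Z => ↾fun a => t.natTrans.app (Z ⊗ X) (tmul a b)
          naturality := by
            intro Z W g
            ext a
            exact (congrArg (t.natTrans.app (W ⊗ X)) (map_whiskerRight_tmul g X a b).symm).trans
              (ConcreteCategory.congr_hom (t.natTrans.naturality (g ▷ X)) (tmul a b)) }
      naturality := by
        intro X Y g
        ext b
        refine ihomObj_ext fun Z a => ?_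
        exact (congrArg (t.natTrans.app (Z ⊗ Y)) (map_whiskerLeft_tmul Z g a b).symm).trans
          (ConcreteCategory.congr_hom (t.natTrans.naturality (Z ◁ g)) (tmul a b)) }

/-- Evaluation of a morphism into the internal hom at a pair of elements. -/
def evalHom {F H G : D ⊛⥤ Type u} (s : H ⟶ ihomObj F G) {X Y : D}
    (a : F.functor.obj X) (b : H.functor.obj Y) : G.functor.obj (X ⊗ Y) :=
  NatTrans.app (F := F.functor) (G := tensorRight Y ⋙ G.functor) (s.natTrans.app Y b) X a

/-- Uncurrying of a morphism into the internal hom. -/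
def uncurryHom {F H G : D ⊛⥤ Type u} (s : H ⟶ ihomObj F G) : F ⊗ H ⟶ G :=
  DayFunctor.tensorDesc
    { app := fun p => ↾fun (q : F.functor.obj p.1 × H.functor.obj p.2) => evalHom s q.1 q.2
      naturality := by
        rintro ⟨X, Y⟩ ⟨X', Y'⟩ ⟨f, g⟩
        ext ⟨a, b⟩
        change evalHom s (F.functor.map f a) (H.functor.map g b) =
          G.functor.map (f ⊗ₘ g) (evalHom s a b)
        have h₀ := ConcreteCategory.congr_hom (s.natTrans.naturality g) b
        have h₁ : evalHom s (F.functor.map f a) (H.functor.map g b) =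
            G.functor.map (X' ◁ g) (evalHom s (F.functor.map f a) b) :=
          congrArg (fun r : F.functor ⟶ tensorRight Y' ⋙ G.functor =>
            r.app X' (F.functor.map f a)) h₀
        have h₂ : evalHom s (F.functor.map f a) b = G.functor.map (f ▷ Y) (evalHom s a b) :=
          ConcreteCategory.congr_hom (NatTrans.naturality (F := F.functor)
            (G := tensorRight Y ⋙ G.functor) (s.natTrans.app Y b) f) a
        rw [h₁, h₂, MonoidalCategory.tensorHom_def]
        exact (ConcreteCategory.congr_hom (G.functor.map_comp _ _) _).symm }

lemma uncurryHom_tmul {F H G : D ⊛⥤ Type u} (s : H ⟶ ihomObj F G) {X Y : D}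
    (a : F.functor.obj X) (b : H.functor.obj Y) :
    (uncurryHom s).natTrans.app (X ⊗ Y) (tmul a b) = evalHom s a b :=
  ConcreteCategory.congr_hom (C := Type u)
    (DayFunctor.η_comp_tensorDesc_app (F := F) (G := H) (H := G) _ X Y)
    (pair (F := F) (H := H) a b)

/-- The tensor-hom bijection for Day convolution. -/
def homEquiv (F H G : D ⊛⥤ Type u) : (F ⊗ H ⟶ G) ≃ (H ⟶ ihomObj F G) where
  toFun := curryHom
  invFun := uncurryHom
  left_inv t := by
    apply DayFunctor.tensor_hom_ext
    intro X Y
    ext ⟨a, b⟩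
    exact uncurryHom_tmul _ a b
  right_inv s := by
    apply DayFunctor.hom_ext
    ext Y b
    refine ihomObj_ext fun X a => ?_
    exact uncurryHom_tmul s a b

lemma homEquiv_naturality (F H' H G : D ⊛⥤ Type u) (f : H' ⟶ H) (t : F ⊗ H ⟶ G) :
    homEquiv F H' G ((tensorLeft F).map f ≫ t) = f ≫ homEquiv F H G t := by
  apply DayFunctor.hom_ext
  ext Y b
  refine ihomObj_ext fun X a => ?_
  exact congrArg (t.natTrans.app (X ⊗ Y)) (whiskerLeft_tmul F f a b)

/-- Day convolution is a closed monoidal structure on `Type u`-valued functors. -/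
instance monoidalClosed : MonoidalClosed (D ⊛⥤ Type u) where
  closed F :=
    { rightAdj := Adjunction.rightAdjointOfEquiv (F := tensorLeft F) (homEquiv F)
        (fun H' H G f t => homEquiv_naturality F H' H G f t)
      adj := Adjunction.adjunctionOfEquivRight (F := tensorLeft F) (homEquiv F)
        (fun H' H G f t => homEquiv_naturality F H' H G f t) }

end DayPresheaf


section Enriched

variable {V : Type*} [Category V] [MonoidalCategory V]

/-- The fully faithful enrichment of `A` along `J : A → D`: hom-objects `D[J a, J b]`. -/
abbrev fullyFaithfulEnrichment (V : Type*) [Category V] [MonoidalCategory V] {A D : Type*}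
    [EnrichedCategory V D] (J : A → D) : EnrichedCategory V A where
  Hom a b := J a ⟶[V] J b
  id a := eId V (J a)
  comp a b c := eComp V (J a) (J b) (J c)
  id_comp a b := e_id_comp V (J a) (J b)
  comp_id a b := e_comp_id V (J a) (J b)
  assoc a b c d := e_assoc V (J a) (J b) (J c) (J d)

variable {D : Type*} [EnrichedCategory V D]

/-- Post-composition with a morphism `g : I ⟶ D[Y, Z]`. -/
def ePost (X : D) {Y Z : D} (g : 𝟙_ V ⟶ (Y ⟶[V] Z)) : (X ⟶[V] Y) ⟶ (X ⟶[V] Z) :=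
  (ρ_ _).inv ≫ _ ◁ g ≫ eComp V X Y Z

/-- Pre-composition with a morphism `f : I ⟶ D[X, Y]`. -/
def ePre {X Y : D} (f : 𝟙_ V ⟶ (X ⟶[V] Y)) (Z : D) : (Y ⟶[V] Z) ⟶ (X ⟶[V] Z) :=
  (λ_ _).inv ≫ f ▷ _ ≫ eComp V X Y Z

lemma ePost_id (X Y : D) : ePost X (eId V Y) = 𝟙 _ := e_comp_id V X Y

lemma ePre_id (X Y : D) : ePre (eId V X) Y = 𝟙 _ := e_id_comp V X Y

lemma eId_ePost {X Y : D} (f : 𝟙_ V ⟶ (X ⟶[V] Y)) : eId V X ≫ ePost X f = f := by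
  have h := e_id_comp V X Y
  calc eId V X ≫ ePost X f
      = f ≫ (λ_ _).inv ≫ eId V X ▷ _ ≫ eComp V X X Y := by
        simp only [ePost, rightUnitor_inv_naturality_assoc, leftUnitor_inv_naturality_assoc,
          unitors_inv_equal, whisker_exchange_assoc]
    _ = f := by rw [h, Category.comp_id]

lemma eComp_ePost {W X Y Z : D} (g : 𝟙_ V ⟶ (Y ⟶[V] Z)) :
    eComp V W X Y ≫ ePost W g = (_ ◁ ePost X g) ≫ eComp V W X Z := by
  simp only [ePost, MonoidalCategory.whiskerLeft_comp, Category.assoc, ← e_assoc]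
  simp only [rightUnitor_inv_naturality_assoc, whisker_exchange_assoc,
    associator_inv_naturality_right_assoc, whiskerLeft_rightUnitor_inv, Category.assoc,
    Iso.hom_inv_id_assoc]

lemma ePost_comp (X : D) {Y Z W : D} (f : 𝟙_ V ⟶ (Y ⟶[V] Z)) (g : 𝟙_ V ⟶ (Z ⟶[V] W)) :
    ePost X (f ≫ ePost Y g) = ePost X f ≫ ePost X g := by
  have h : ePost X f ≫ ePost X g =
      (ρ_ _).inv ≫ _ ◁ f ≫ _ ◁ ePost Y g ≫ eComp V X Y W := by
    rw [← eComp_ePost]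
    simp only [ePost, Category.assoc]
  rw [h, ePost, MonoidalCategory.whiskerLeft_comp, Category.assoc]

lemma ePre_ePost {X Y Z W : D} (f : 𝟙_ V ⟶ (X ⟶[V] Y)) (g : 𝟙_ V ⟶ (Z ⟶[V] W)) :
    ePre f Z ≫ ePost X g = ePost Y g ≫ ePre f W := by
  simp only [ePre, Category.assoc, eComp_ePost, leftUnitor_inv_naturality_assoc,
    whisker_exchange_assoc]

lemma ePre_comp {X Y Z : D} (f : 𝟙_ V ⟶ (X ⟶[V] Y)) (g : 𝟙_ V ⟶ (Y ⟶[V] Z)) (W : D) :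
    ePre (f ≫ ePost X g) W = ePre g W ≫ ePre f W := by
  have h : ePre g W ≫ ePre f W =
      (λ_ _).inv ≫ f ▷ _ ≫ _ ◁ ePre g W ≫ eComp V X Y W := by
    conv_lhs => rw [ePre.eq_def f]
    rw [leftUnitor_inv_naturality_assoc, whisker_exchange_assoc]
  rw [h, ePre, ePost]
  simp only [comp_whiskerRight, Category.assoc, ← e_assoc', ePre,
    MonoidalCategory.whiskerLeft_comp]
  simp

end Enriched

/-- A `V`-enriched relative monad with root the map of objects `J : A → D`.  Composition in a
`V`-category is Mathlib's `D[X, Y] ⊗ D[Y, Z] ⟶ D[X, Z]`, in diagrammatic order. -/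
structure EnrichedRelativeMonad (V : Type*) [Category V] [MonoidalCategory V] {A D : Type*}
    [EnrichedCategory V D] (J : A → D) where
  /-- the objects `T a` -/
  obj : A → D
  /-- the units `η_a : I ⟶ D[J a, T a]` -/
  unit (a : A) : 𝟙_ V ⟶ (J a ⟶[V] obj a)
  /-- the extension morphisms `D[J a, T b] ⟶ D[T a, T b]` -/
  ext (a b : A) : (J a ⟶[V] obj b) ⟶ (obj a ⟶[V] obj b)
  unit_ext (a : A) : unit a ≫ ext a a = eId V (obj a)
  unit_comp_ext (a b : A) :
    (unit a ⊗ₘ ext a b) ≫ eComp V (J a) (obj a) (obj b) = (λ_ (J a ⟶[V] obj b)).hom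
  ext_comp_ext (a b c : A) :
    (ext a b ⊗ₘ ext b c) ≫ eComp V (obj a) (obj b) (obj c) =
      ((J a ⟶[V] obj b) ◁ ext b c) ≫ eComp V (J a) (obj b) (obj c) ≫ ext a c

namespace EnrichedRelativeMonad

variable {V : Type*} [Category V] [MonoidalCategory V] {A D : Type*} [EnrichedCategory V D]
  {J : A → D}

/-- Morphisms of enriched relative monads: families `I ⟶ D[T a, S a]` compatible with units and
extensions. -/
@[ext]
structure Hom (M N : EnrichedRelativeMonad V J) where
  app (a : A) : 𝟙_ V ⟶ (M.obj a ⟶[V] N.obj a)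
  unit_app (a : A) : M.unit a ≫ ePost (J a) (app a) = N.unit a
  ext_app (a b : A) :
    M.ext a b ≫ ePost (M.obj a) (app b) =
      ePost (J a) (app b) ≫ N.ext a b ≫ ePre (app a) (N.obj b)

instance : Category (EnrichedRelativeMonad V J) where
  Hom := Hom
  id M :=
    { app a := eId V (M.obj a)
      unit_app a := by rw [ePost_id, Category.comp_id]
      ext_app a b := by simp only [ePost_id, ePre_id, Category.comp_id, Category.id_comp] }
  comp {M N P} f g :=
    { app a := f.app a ≫ ePost (M.obj a) (g.app a)
      unit_app a := by rw [ePost_comp, ← Category.assoc, f.unit_app, g.unit_app]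
      ext_app a b := by
        rw [ePost_comp, ePost_comp, ePre_comp, ← Category.assoc, f.ext_app]
        simp only [Category.assoc]
        rw [ePre_ePost, ← Category.assoc (N.ext a b), g.ext_app]
        simp only [Category.assoc] }
  id_comp f := Hom.ext (funext fun a => eId_ePost (f.app a))
  comp_id f := Hom.ext (funext fun a => by
    change f.app a ≫ ePost _ (eId V _) = f.app a
    rw [ePost_id, Category.comp_id])
  assoc f g h := Hom.ext (funext fun a => by
    change (f.app a ≫ ePost _ (g.app a)) ≫ ePost _ (h.app a) =
      f.app a ≫ ePost _ (g.app a ≫ ePost _ (h.app a))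
    rw [ePost_comp, Category.assoc])

end EnrichedRelativeMonad

/-- A strong relative monad, in Kleisli form, with root the map of objects `J : A → C`. -/
structure StrongRelativeMonad {A C : Type*} [Category C] [MonoidalCategory C] (J : A → C) where
  /-- the objects `T a` -/
  obj : A → C
  /-- the units `η_a : J a ⟶ T a` -/
  unit (a : A) : J a ⟶ obj a
  /-- the extension of `f : Γ ⊗ J a ⟶ T b` to `Γ ⊗ T a ⟶ T b` -/
  ext {Γ : C} {a b : A} (f : Γ ⊗ J a ⟶ obj b) : Γ ⊗ obj a ⟶ obj b
  ext_natural {Γ Δ : C} {a b : A} (h : Δ ⟶ Γ) (f : Γ ⊗ J a ⟶ obj b) :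
    ext (h ▷ J a ≫ f) = h ▷ obj a ≫ ext f
  unit_ext (a : A) : ext ((λ_ (J a)).hom ≫ unit a) = (λ_ (obj a)).hom
  unit_comp_ext {Γ : C} {a b : A} (f : Γ ⊗ J a ⟶ obj b) : Γ ◁ unit a ≫ ext f = f
  ext_comp_ext {Γ Δ : C} {a b c : A} (f : Γ ⊗ J a ⟶ obj b) (g : Δ ⊗ J b ⟶ obj c) :
    (α_ Δ Γ (obj a)).hom ≫ Δ ◁ ext f ≫ ext g = ext ((α_ Δ Γ (J a)).hom ≫ Δ ◁ f ≫ ext g)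

namespace StrongRelativeMonad

variable {A C : Type*} [Category C] [MonoidalCategory C] {J : A → C}

/-- Morphisms of strong relative monads. -/
@[ext]
structure Hom (M N : StrongRelativeMonad J) where
  app (a : A) : M.obj a ⟶ N.obj a
  unit_app (a : A) : M.unit a ≫ app a = N.unit a
  ext_app {Γ : C} {a b : A} (f : Γ ⊗ J a ⟶ M.obj b) :
    M.ext f ≫ app b = Γ ◁ app a ≫ N.ext (f ≫ app b)

instance : Category (StrongRelativeMonad J) where
  Hom := Hom
  id M :=
    { app a := 𝟙 (M.obj a)
      unit_app a := Category.comp_id _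
      ext_app f := by simp }
  comp f g :=
    { app a := f.app a ≫ g.app a
      unit_app a := by rw [← Category.assoc, f.unit_app, g.unit_app]
      ext_app h := by
        rw [← Category.assoc, f.ext_app, Category.assoc, g.ext_app,
          MonoidalCategory.whiskerLeft_comp, Category.assoc, Category.assoc] }
  id_comp f := Hom.ext (funext fun _ => Category.id_comp _)
  comp_id f := Hom.ext (funext fun _ => Category.comp_id _)
  assoc f g h := Hom.ext (funext fun _ => Category.assoc _ _ _)

end StrongRelativeMonad

section Presheaf

variable {C : Type u} [SmallCategory C] [MonoidalCategory C]

/-- The enrichment of `C` in presheaves on `C` with Day convolution that is fully faithful along the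
Yoneda embedding: `C[X, Y]` is the internal hom from `C(-, X)` to `C(-, Y)`. -/
instance presheafEnrichment : EnrichedCategory (Cᵒᵖ ⊛⥤ Type u) C :=
  letI := MonoidalClosed.enrichedCategorySelf (Cᵒᵖ ⊛⥤ Type u)
  fullyFaithfulEnrichment (D := Cᵒᵖ ⊛⥤ Type u) (Cᵒᵖ ⊛⥤ Type u) fun X : C => .mk (yoneda.obj X)

/-- The Yoneda bijection `C[X, Y](Γ) ≅ C(Γ ⊗ X, Y)`: an element of `C[X, Y](Γ)` is a natural
transformation `C(-, X) ⟶ C(- ⊗ Γ, Y)`, which is evaluated at the identity of `X`. -/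
def presheafHomElement [BraidedCategory C] {X Y Γ : C}
    (t : (X ⟶[Cᵒᵖ ⊛⥤ Type u] Y).functor.obj (op Γ)) : Γ ⊗ X ⟶ Y :=
  (β_ Γ X).hom ≫
    NatTrans.app (F := yoneda.obj X) (G := tensorRight (op Γ) ⋙ yoneda.obj Y) t (op X) (𝟙 X)

/-- The morphism `X ⟶ Y` underlying a global element `I ⟶ C[X, Y]`.  Here `DayFunctor.ν` picks out
the universal element of the Day unit at the unit object of `C`. -/
def presheafHomUnderlying [BraidedCategory C] {X Y : C}
    (t : 𝟙_ (Cᵒᵖ ⊛⥤ Type u) ⟶ (X ⟶[Cᵒᵖ ⊛⥤ Type u] Y)) : X ⟶ Y :=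
  (λ_ X).inv ≫ presheafHomElement (Γ := 𝟙_ C)
    (t.natTrans.app (𝟙_ Cᵒᵖ) (DayFunctor.ν Cᵒᵖ (Type u) PUnit.unit))

/-- The strong relative monad `N` has the same objects `T a` as the enriched relative monad `M`, its
units are those underlying the units of `M`, and its extension operators are those of `M` under the
bijections `C[X, Y](Γ) ≅ C(Γ ⊗ X, Y)`. -/
structure StrongRelativeMonad.IsUnderlying [BraidedCategory C] {A : Type w} {J : A → C}
    (M : EnrichedRelativeMonad (Cᵒᵖ ⊛⥤ Type u) J) (N : StrongRelativeMonad J) : Prop where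
  obj_eq (a : A) : N.obj a = M.obj a
  unit_eq (a : A) : N.unit a ≫ eqToHom (obj_eq a) = presheafHomUnderlying (M.unit a)
  ext_eq (Γ : C) (a b : A) (t : (J a ⟶[Cᵒᵖ ⊛⥤ Type u] M.obj b).functor.obj (op Γ)) :
    N.ext (presheafHomElement t ≫ eqToHom (obj_eq b).symm) ≫ eqToHom (obj_eq b) =
      Γ ◁ eqToHom (obj_eq a) ≫ presheafHomElement ((M.ext a b).natTrans.app (op Γ) t)

end Presheaf

end

/-! By Yoneda, `C[X, Y](Γ)` is the set of morphisms `Γ ⊗ X ⟶ Y`, so a presheaf map `C[X, Y] ⟶ C[X',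
Y']` amounts to maps from morphisms `Γ ⊗ X ⟶ Y` to morphisms `Γ ⊗ X' ⟶ Y'`, natural in `Γ`, and a
global element of `C[X, Y]` amounts to a morphism `X ⟶ Y`. The data of the two kinds of monad
therefore correspond bijectively, and so do the data of their morphisms. It remains to match the
laws.

Each enriched law equates two presheaf maps. A map out of a Day convolution is determined by its
values on pairs of elements, and a map out of the Day unit by its value at one universal element.
Testing the laws there requires the composition of `C[-, -]` in terms of morphisms `Γ ⊗ X ⟶ Y`,
which is `presheafHomElement_eComp`; pre- and postcomposition with a global element follow from it.
The results are `comp_eq_eId_iff`, `eComp_unit_iff`, `eComp_ext_iff` and `comp_ePost_iff`. As these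
are equivalences, they serve both functors.

Symmetry enters because the internal hom puts the parameter on the right (`X ⊗ Γ`) and the strong
monad on the left (`Γ ⊗ X`). Enriched composition is moreover diagrammatic, so a composite lives
over `Γ ⊗ Δ` rather than `Δ ⊗ Γ`; the resulting braiding is absorbed by naturality of extension. -/

noncomputable section

/-! ### Day convolution and its closed structure, computed on elements -/

namespace DayPresheaf

variable {D : Type u} [SmallCategory D] [MonoidalCategory D]

/-- The universal element of the Day convolution unit. -/
def unitElement : (𝟙_ (D ⊛⥤ Type u)).functor.obj (𝟙_ D) :=
  DayFunctor.ν D (Type u) PUnit.unit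

lemma hom_ext_unit {F : D ⊛⥤ Type u} {s t : 𝟙_ (D ⊛⥤ Type u) ⟶ F}
    (h : s.natTrans.app (𝟙_ D) unitElement = t.natTrans.app (𝟙_ D) unitElement) : s = t := by
  apply DayFunctor.unit_hom_ext
  ext x
  exact h

lemma unitDesc_unitElement {F : D ⊛⥤ Type u} (x : F.functor.obj (𝟙_ D)) :
    (DayFunctor.unitDesc (↾fun _ => x : 𝟙_ (Type u) ⟶ F.functor.obj (𝟙_ D))).natTrans.app (𝟙_ D)
      unitElement = x :=
  ConcreteCategory.congr_hom (C := Type u)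
    (DayFunctor.ν_comp_unitDesc (↾fun _ => x : 𝟙_ (Type u) ⟶ F.functor.obj (𝟙_ D))) PUnit.unit

lemma hom_ext_tmul {F H G : D ⊛⥤ Type u} {s t : F ⊗ H ⟶ G}
    (h : ∀ (X Y : D) (a : F.functor.obj X) (b : H.functor.obj Y),
      s.natTrans.app (X ⊗ Y) (tmul a b) = t.natTrans.app (X ⊗ Y) (tmul a b)) : s = t := by
  apply DayFunctor.tensor_hom_ext
  intro X Y
  ext ⟨a, b⟩
  exact h X Y a b

lemma comp_app {F G H : D ⊛⥤ Type u} (s : F ⟶ G) (t : G ⟶ H) {X : D} (a : F.functor.obj X) :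
    (s ≫ t).natTrans.app X a = t.natTrans.app X (s.natTrans.app X a) := rfl

lemma app_map {F G : D ⊛⥤ Type u} (s : F ⟶ G) {X Y : D} (f : X ⟶ Y) (a : F.functor.obj X) :
    s.natTrans.app Y (F.functor.map f a) = G.functor.map f (s.natTrans.app X a) :=
  ConcreteCategory.congr_hom (s.natTrans.naturality f) a

lemma whiskerRight_tmul {F F' : D ⊛⥤ Type u} (f : F ⟶ F') (H : D ⊛⥤ Type u) {X Y : D}
    (a : F.functor.obj X) (b : H.functor.obj Y) :
    (f ▷ H).natTrans.app (X ⊗ Y) (tmul a b) = tmul (f.natTrans.app X a) b :=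
  ConcreteCategory.congr_hom (C := Type u)
    (LawfulDayConvolutionMonoidalCategoryStruct.convolutionExtensionUnit_comp_ι_map_whiskerRight_app
      (C := D) (Type u) f H X Y) (pair (F := F) (H := H) a b)

lemma tensorHom_tmul {F F' H H' : D ⊛⥤ Type u} (f : F ⟶ F') (g : H ⟶ H') {X Y : D}
    (a : F.functor.obj X) (b : H.functor.obj Y) :
    (f ⊗ₘ g).natTrans.app (X ⊗ Y) (tmul a b) = tmul (f.natTrans.app X a) (g.natTrans.app Y b) := by
  rw [MonoidalCategory.tensorHom_def, comp_app, whiskerRight_tmul, whiskerLeft_tmul]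

lemma associator_hom_tmul {F G H : D ⊛⥤ Type u} {X Y Z : D} (a : F.functor.obj X)
    (b : G.functor.obj Y) (c : H.functor.obj Z) :
    (α_ F G H).hom.natTrans.app ((X ⊗ Y) ⊗ Z) (tmul (tmul a b) c) =
      (F ⊗ G ⊗ H).functor.map (α_ X Y Z).inv (tmul a (tmul b c)) :=
  ConcreteCategory.congr_hom (C := Type u)
    (LawfulDayConvolutionMonoidalCategoryStruct.associator_hom_unit_unit
      (C := D) (Type u) F G H X Y Z)
    (((a, b), c) : (F.functor.obj X × G.functor.obj Y) × H.functor.obj Z)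

lemma associator_inv_tmul {F G H : D ⊛⥤ Type u} {X Y Z : D} (a : F.functor.obj X)
    (b : G.functor.obj Y) (c : H.functor.obj Z) :
    (α_ F G H).inv.natTrans.app (X ⊗ Y ⊗ Z) (tmul a (tmul b c)) =
      ((F ⊗ G) ⊗ H).functor.map (α_ X Y Z).hom (tmul (tmul a b) c) := by
  have h := congrArg (fun x => (α_ F G H).inv.natTrans.app _ ((F ⊗ G ⊗ H).functor.map (α_ X Y Z).hom x))
    (associator_hom_tmul a b c)
  simp only [← Functor.map_comp_apply, Iso.inv_hom_id, Functor.map_id_apply] at h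
  rw [← h, app_map, ← comp_app, Iso.hom_inv_id]
  rfl

lemma leftUnitor_hom_tmul {F : D ⊛⥤ Type u} {X : D} (a : F.functor.obj X) :
    (λ_ F).hom.natTrans.app (𝟙_ D ⊗ X) (tmul unitElement a) = F.functor.map (λ_ X).inv a :=
  ConcreteCategory.congr_hom (C := Type u)
    (LawfulDayConvolutionMonoidalCategoryStruct.leftUnitor_hom_unit_app
      (C := D) (Type u) F X) ((PUnit.unit, a) : PUnit × F.functor.obj X)

lemma rightUnitor_hom_tmul {F : D ⊛⥤ Type u} {X : D} (a : F.functor.obj X) :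
    (ρ_ F).hom.natTrans.app (X ⊗ 𝟙_ D) (tmul a unitElement) = F.functor.map (ρ_ X).inv a :=
  ConcreteCategory.congr_hom (C := Type u)
    (LawfulDayConvolutionMonoidalCategoryStruct.rightUnitor_hom_unit_app
      (C := D) (Type u) F X) ((a, PUnit.unit) : F.functor.obj X × PUnit)

/-- An arbitrary `X` is not literally of the form `𝟙_ D ⊗ X`, so the representing pair has to be
transported along the unitor of `D`. -/
lemma leftUnitor_inv_app {F : D ⊛⥤ Type u} {X : D} (a : F.functor.obj X) :
    (λ_ F).inv.natTrans.app X a =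
      (𝟙_ (D ⊛⥤ Type u) ⊗ F).functor.map (λ_ X).hom (tmul unitElement a) := by
  have h : (λ_ F).hom.natTrans.app X
      ((𝟙_ (D ⊛⥤ Type u) ⊗ F).functor.map (λ_ X).hom (tmul unitElement a)) = a := by
    rw [app_map, leftUnitor_hom_tmul, ← Functor.map_comp_apply, Iso.inv_hom_id,
      Functor.map_id_apply]
  rw [← congrArg ((λ_ F).inv.natTrans.app X) h, ← comp_app, Iso.hom_inv_id]
  rfl

lemma rightUnitor_inv_app {F : D ⊛⥤ Type u} {X : D} (a : F.functor.obj X) :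
    (ρ_ F).inv.natTrans.app X a =
      (F ⊗ 𝟙_ (D ⊛⥤ Type u)).functor.map (ρ_ X).hom (tmul a unitElement) := by
  have h : (ρ_ F).hom.natTrans.app X
      ((F ⊗ 𝟙_ (D ⊛⥤ Type u)).functor.map (ρ_ X).hom (tmul a unitElement)) = a := by
    rw [app_map, rightUnitor_hom_tmul, ← Functor.map_comp_apply, Iso.inv_hom_id,
      Functor.map_id_apply]
  rw [← congrArg ((ρ_ F).inv.natTrans.app X) h, ← comp_app, Iso.hom_inv_id]
  rfl

/-- Evaluation of an element of the internal hom. -/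
def elemApp {F G : D ⊛⥤ Type u} {X Y : D} (s : ((ihom F).obj G).functor.obj Y)
    (a : F.functor.obj X) : G.functor.obj (X ⊗ Y) :=
  NatTrans.app (F := F.functor) (G := tensorRight Y ⋙ G.functor) s X a

/-- The closed structure comes from the adjunction given by `homEquiv`, so abstract currying is the
concrete one. This makes evaluation, composition and identities of internal homs computable on
pairs. -/
lemma curry_app {F G H : D ⊛⥤ Type u} (t : F ⊗ H ⟶ G) {X Y : D} (a : F.functor.obj X)
    (b : H.functor.obj Y) :
    elemApp ((MonoidalClosed.curry t).natTrans.app Y b) a = t.natTrans.app (X ⊗ Y) (tmul a b) := by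
  have h : MonoidalClosed.curry t = homEquiv F H G t := by
    change (Adjunction.adjunctionOfEquivRight (F := tensorLeft F) (homEquiv F) _).homEquiv H G t = _
    simp [Adjunction.adjunctionOfEquivRight]
  rw [h]
  rfl

lemma ev_tmul {F G : D ⊛⥤ Type u} {X Y : D} (a : F.functor.obj X)
    (s : ((ihom F).obj G).functor.obj Y) :
    ((ihom.ev F).app G).natTrans.app (X ⊗ Y) (tmul a s) = elemApp s a := by
  have h := curry_app (MonoidalClosed.uncurry (𝟙 ((ihom F).obj G))) a s
  rw [MonoidalClosed.curry_uncurry, MonoidalClosed.uncurry_id_eq_ev] at h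
  exact h.symm

/-- Transposed, composition is reassociation followed by two evaluations. These end over `(X ⊗ Y) ⊗
Z`, whereas the composite is an element over `Y ⊗ Z` evaluated at `X`; hence the associator. -/
lemma elemApp_comp {F G H : D ⊛⥤ Type u} {X Y Z : D} (s : ((ihom F).obj G).functor.obj Y)
    (t : ((ihom G).obj H).functor.obj Z) (a : F.functor.obj X) :
    elemApp ((MonoidalClosed.comp F G H).natTrans.app (Y ⊗ Z) (tmul s t)) a =
      H.functor.map (α_ X Y Z).hom (elemApp t (elemApp s a)) := by
  rw [MonoidalClosed.comp_eq, curry_app, MonoidalClosed.compTranspose_eq, comp_app,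
    associator_inv_tmul, app_map, comp_app]
  congr 1
  refine Eq.trans ?_ (ev_tmul (elemApp s a) t)
  congr 1
  exact (whiskerRight_tmul ((ihom.ev F).app G) ((ihom G).obj H) (tmul a s) t).trans
    (congrArg (tmul · t) (ev_tmul a s))

lemma elemApp_id (F : D ⊛⥤ Type u) {X : D} (a : F.functor.obj X) :
    elemApp ((MonoidalClosed.id F).natTrans.app (𝟙_ D) unitElement) a =
      F.functor.map (ρ_ X).inv a := by
  rw [MonoidalClosed.id_eq, curry_app, rightUnitor_hom_tmul]

end DayPresheaf

/-! ### The hom-presheaves `C[X, Y]` and the Yoneda bijection -/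

section PresheafHom

variable {C : Type u} [SmallCategory C] [MonoidalCategory C]

/-- The hom-object of the presheaf enrichment, written `C[X, Y]` in comments. -/
abbrev presheafHom (X Y : C) : Cᵒᵖ ⊛⥤ Type u := X ⟶[Cᵒᵖ ⊛⥤ Type u] Y

open DayPresheaf

/-- Evaluation of an element of `C[X, Y](Γ)` at a morphism `Z ⟶ X`. -/
def presheafHomApp {X Y Γ Z : C} (t : (presheafHom X Y).functor.obj (op Γ)) (a : Z ⟶ X) : Z ⊗ Γ ⟶ Y :=
  NatTrans.app (F := yoneda.obj X) (G := tensorRight (op Γ) ⋙ yoneda.obj Y) t (op Z) a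

/-- This is the Yoneda argument: `a` is the restriction of `𝟙 X` along `a`, and `t` is natural. -/
lemma presheafHomApp_eq {X Y Γ Z : C} (t : (presheafHom X Y).functor.obj (op Γ)) (a : Z ⟶ X) :
    presheafHomApp t a = a ▷ Γ ≫ presheafHomApp t (𝟙 X) := by
  have h := ConcreteCategory.congr_hom (NatTrans.naturality (F := yoneda.obj X)
    (G := tensorRight (op Γ) ⋙ yoneda.obj Y) t a.op) (𝟙 X)
  refine Eq.trans (congrArg (presheafHomApp t) (Category.comp_id a).symm) h

lemma presheafHom_ext {X Y Γ : C} {s t : (presheafHom X Y).functor.obj (op Γ)}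
    (h : presheafHomApp s (𝟙 X) = presheafHomApp t (𝟙 X)) : s = t :=
  ihomObj_ext fun Z (a : Z.unop ⟶ X) =>
    (presheafHomApp_eq s a).trans ((congrArg (a ▷ Γ ≫ ·) h).trans (presheafHomApp_eq t a).symm)

lemma presheafHomApp_map {X Y Γ Δ Z : C} (h : Δ ⟶ Γ)
    (t : (presheafHom X Y).functor.obj (op Γ)) (a : Z ⟶ X) :
    presheafHomApp ((presheafHom X Y).functor.map h.op t) a = Z ◁ h ≫ presheafHomApp t a := rfl

/-- Passing to `Cᵒᵖ` reverses the associator of `elemApp_comp`; `op Γ ⊗ op Δ` is `op (Γ ⊗ Δ)` by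
definition. -/
lemma presheafHomApp_eComp {X Y Z Γ Δ W : C} (s : (presheafHom X Y).functor.obj (op Γ))
    (t : (presheafHom Y Z).functor.obj (op Δ)) (a : W ⟶ X) :
    presheafHomApp (Γ := Γ ⊗ Δ)
      ((eComp (Cᵒᵖ ⊛⥤ Type u) X Y Z).natTrans.app (op Γ ⊗ op Δ) (tmul s t)) a =
      (α_ W Γ Δ).inv ≫ presheafHomApp t (presheafHomApp s a) :=
  elemApp_comp (F := .mk (yoneda.obj X)) (G := .mk (yoneda.obj Y)) (H := .mk (yoneda.obj Z))
    (X := op W) s t a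

lemma presheafHomApp_eId {X W : C} (a : W ⟶ X) :
    presheafHomApp (Γ := 𝟙_ C)
      ((eId (Cᵒᵖ ⊛⥤ Type u) X).natTrans.app (𝟙_ Cᵒᵖ) unitElement) a = (ρ_ W).hom ≫ a :=
  elemApp_id (.mk (yoneda.obj X)) (X := op W) a

section Braided

variable [BraidedCategory C]

lemma presheafHomElement_eq {X Y Γ : C} (t : (presheafHom X Y).functor.obj (op Γ)) :
    presheafHomElement t = (β_ Γ X).hom ≫ presheafHomApp t (𝟙 X) := rfl

lemma presheafHomElement_map {X Y Γ Δ : C} (h : Δ ⟶ Γ) (t : (presheafHom X Y).functor.obj (op Γ)) :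
    presheafHomElement ((presheafHom X Y).functor.map h.op t) = h ▷ X ≫ presheafHomElement t := by
  simp [presheafHomElement_eq, presheafHomApp_map]

lemma presheafHomElement_unitElement {X Y : C} (g : 𝟙_ (Cᵒᵖ ⊛⥤ Type u) ⟶ presheafHom X Y) :
    presheafHomElement (Γ := 𝟙_ C) (g.natTrans.app (𝟙_ Cᵒᵖ) unitElement) =
      (λ_ X).hom ≫ presheafHomUnderlying g :=
  (Iso.hom_inv_id_assoc _ _).symm

lemma presheafHomElement_eId (X : C) :
    presheafHomElement (Γ := 𝟙_ C) ((eId (Cᵒᵖ ⊛⥤ Type u) X).natTrans.app (𝟙_ Cᵒᵖ) unitElement) =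
      (λ_ X).hom := by
  simp [presheafHomElement_eq, presheafHomApp_eId]

lemma presheafHomUnderlying_eId (X : C) :
    presheafHomUnderlying (eId (Cᵒᵖ ⊛⥤ Type u) X) = 𝟙 X := by
  rw [← cancel_epi (λ_ X).hom, ← presheafHomElement_unitElement, presheafHomElement_eId,
    Category.comp_id]

end Braided

variable [SymmetricCategory C]

lemma presheafHomApp_id {X Y Γ : C} (t : (presheafHom X Y).functor.obj (op Γ)) :
    presheafHomApp t (𝟙 X) = (β_ X Γ).hom ≫ presheafHomElement t := by
  rw [presheafHomElement_eq, SymmetricCategory.symmetry_assoc]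

/-- The Yoneda bijection `C[X, Y](Γ) ≃ C(Γ ⊗ X, Y)`. -/
def presheafHomEquiv (X Y Γ : C) : (presheafHom X Y).functor.obj (op Γ) ≃ (Γ ⊗ X ⟶ Y) where
  toFun := presheafHomElement
  invFun f := (show yoneda.obj X ⟶ tensorRight (op Γ) ⋙ yoneda.obj Y from
    { app := fun Z => ↾fun (a : Z.unop ⟶ X) => a ▷ Γ ≫ (β_ X Γ).hom ≫ f
      naturality := by
        intro Z W g
        ext a
        change (g.unop ≫ a) ▷ Γ ≫ (β_ X Γ).hom ≫ f =
          g.unop ▷ Γ ≫ a ▷ Γ ≫ (β_ X Γ).hom ≫ f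
        rw [comp_whiskerRight, Category.assoc] })
  left_inv t := presheafHom_ext <| by
    change 𝟙 X ▷ Γ ≫ (β_ X Γ).hom ≫ presheafHomElement t = _
    rw [id_whiskerRight, Category.id_comp, presheafHomApp_id]
  right_inv f := by
    change (β_ Γ X).hom ≫ 𝟙 X ▷ Γ ≫ (β_ X Γ).hom ≫ f = f
    rw [id_whiskerRight, Category.id_comp, SymmetricCategory.symmetry_assoc]

lemma presheafHomElement_injective {X Y Γ : C} {s t : (presheafHom X Y).functor.obj (op Γ)}
    (h : presheafHomElement s = presheafHomElement t) : s = t :=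
  (presheafHomEquiv X Y Γ).injective h

@[simp]
lemma presheafHomElement_symm {X Y Γ : C} (f : Γ ⊗ X ⟶ Y) :
    presheafHomElement ((presheafHomEquiv X Y Γ).symm f) = f :=
  (presheafHomEquiv X Y Γ).apply_symm_apply f

@[simp]
lemma presheafHomEquiv_symm_element {X Y Γ : C} (t : (presheafHom X Y).functor.obj (op Γ)) :
    (presheafHomEquiv X Y Γ).symm (presheafHomElement t) = t :=
  (presheafHomEquiv X Y Γ).symm_apply_apply t

lemma presheafHomEquiv_symm_natural {X Y Γ Δ : C} (h : Δ ⟶ Γ) (f : Γ ⊗ X ⟶ Y) :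
    (presheafHomEquiv X Y Δ).symm (h ▷ X ≫ f) =
      (presheafHom X Y).functor.map h.op ((presheafHomEquiv X Y Γ).symm f) :=
  presheafHomElement_injective <| by simp [presheafHomElement_map]

/-- Moving both parameters to the left produces braidings of `X` past `Γ` and `Δ`. Two hexagons
split them, symmetry cancels them in inverse pairs, and only the exchange of `Γ` with `Δ` survives.
-/
lemma presheafHomElement_eComp {X Y Z Γ Δ : C} (s : (presheafHom X Y).functor.obj (op Γ))
    (t : (presheafHom Y Z).functor.obj (op Δ)) :
    presheafHomElement (Γ := Γ ⊗ Δ)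
      ((eComp (Cᵒᵖ ⊛⥤ Type u) X Y Z).natTrans.app (op Γ ⊗ op Δ) (tmul s t)) =
      (β_ Γ Δ).hom ▷ X ≫ (α_ Δ Γ X).hom ≫ Δ ◁ presheafHomElement s ≫ presheafHomElement t := by
  rw [presheafHomElement_eq, presheafHomApp_eComp, presheafHomApp_eq, presheafHomApp_id,
    presheafHomApp_id]
  simp only [comp_whiskerRight, Category.assoc, BraidedCategory.braiding_naturality_left_assoc]
  rw [BraidedCategory.braiding_tensor_left_hom]
  simp only [Category.assoc, Iso.hom_inv_id_assoc]
  rw [BraidedCategory.braiding_naturality_left_assoc, BraidedCategory.braiding_tensor_left_hom,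
    ← MonoidalCategory.whiskerLeft_comp_assoc Δ (β_ Γ X).hom, SymmetricCategory.symmetry]
  simp only [Category.assoc, Iso.inv_hom_id_assoc]
  rw [← MonoidalCategory.whiskerLeft_comp_assoc Γ (β_ Δ X).hom, SymmetricCategory.symmetry]
  simp

lemma hom_ext_presheafHomElement {X Y X' Y' : C} {p q : presheafHom X Y ⟶ presheafHom X' Y'}
    (h : ∀ (Γ : C) (t : (presheafHom X Y).functor.obj (op Γ)),
      presheafHomElement (p.natTrans.app (op Γ) t) =
        presheafHomElement (q.natTrans.app (op Γ) t)) : p = q := by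
  apply DayFunctor.hom_ext
  ext Γ t
  exact presheafHomElement_injective (h Γ.unop t)

/-- The bijection between global elements of `C[X, Y]` and morphisms `X ⟶ Y`. -/
def presheafHomUnderlyingEquiv (X Y : C) : (𝟙_ (Cᵒᵖ ⊛⥤ Type u) ⟶ presheafHom X Y) ≃ (X ⟶ Y) where
  toFun := presheafHomUnderlying
  invFun f := DayFunctor.unitDesc
    (↾fun _ => (presheafHomEquiv X Y (𝟙_ C)).symm ((λ_ X).hom ≫ f))
  left_inv g := hom_ext_unit <| by
    rw [unitDesc_unitElement, ← presheafHomElement_unitElement]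
    exact presheafHomEquiv_symm_element _
  right_inv f := by
    rw [← cancel_epi (λ_ X).hom, ← presheafHomElement_unitElement, unitDesc_unitElement,
      presheafHomElement_symm]

lemma presheafHomUnderlying_injective {X Y : C} {g h : 𝟙_ (Cᵒᵖ ⊛⥤ Type u) ⟶ presheafHom X Y}
    (e : presheafHomUnderlying g = presheafHomUnderlying h) : g = h :=
  (presheafHomUnderlyingEquiv X Y).injective e

@[simp]
lemma presheafHomUnderlying_symm {X Y : C} (f : X ⟶ Y) :
    presheafHomUnderlying ((presheafHomUnderlyingEquiv X Y).symm f) = f :=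
  (presheafHomUnderlyingEquiv X Y).apply_symm_apply f

/-- This is `presheafHomElement_eComp` with `Δ` the unit object and `g` evaluated at the universal
element; the braiding with the unit cancels against the unitors. -/
lemma presheafHomElement_ePost (X : C) {Y Z Γ : C} (g : 𝟙_ (Cᵒᵖ ⊛⥤ Type u) ⟶ presheafHom Y Z)
    (t : (presheafHom X Y).functor.obj (op Γ)) :
    presheafHomElement ((ePost X g).natTrans.app (op Γ) t) =
      presheafHomElement t ≫ presheafHomUnderlying g := by
  have h : (ePost X g).natTrans.app (op Γ) t = (presheafHom X Z).functor.map (ρ_ Γ).inv.op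
      ((eComp (Cᵒᵖ ⊛⥤ Type u) X Y Z).natTrans.app (op Γ ⊗ 𝟙_ Cᵒᵖ)
        (tmul t (g.natTrans.app (𝟙_ Cᵒᵖ) unitElement))) := by
    rw [ePost, comp_app, comp_app, rightUnitor_inv_app, app_map, app_map, whiskerLeft_tmul]
    rfl
  rw [h, presheafHomElement_map]
  erw [presheafHomElement_eComp]
  rw [presheafHomElement_unitElement]
  simp

lemma presheafHomElement_ePre {X Y Γ : C} (f : 𝟙_ (Cᵒᵖ ⊛⥤ Type u) ⟶ presheafHom X Y) (Z : C)
    (t : (presheafHom Y Z).functor.obj (op Γ)) :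
    presheafHomElement ((ePre f Z).natTrans.app (op Γ) t) =
      Γ ◁ presheafHomUnderlying f ≫ presheafHomElement t := by
  have h : (ePre f Z).natTrans.app (op Γ) t = (presheafHom X Z).functor.map (λ_ Γ).inv.op
      ((eComp (Cᵒᵖ ⊛⥤ Type u) X Y Z).natTrans.app (𝟙_ Cᵒᵖ ⊗ op Γ)
        (tmul (f.natTrans.app (𝟙_ Cᵒᵖ) unitElement) t)) := by
    rw [ePre, comp_app, comp_app, leftUnitor_inv_app, app_map, app_map, whiskerRight_tmul]
    rfl
  rw [h, presheafHomElement_map]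
  erw [presheafHomElement_eComp]
  rw [presheafHomElement_unitElement]
  simp

lemma presheafHomUnderlying_comp_ePost {X Y Z : C} (f : 𝟙_ (Cᵒᵖ ⊛⥤ Type u) ⟶ presheafHom X Y)
    (g : 𝟙_ (Cᵒᵖ ⊛⥤ Type u) ⟶ presheafHom Y Z) :
    presheafHomUnderlying (f ≫ ePost X g) = presheafHomUnderlying f ≫ presheafHomUnderlying g := by
  rw [← cancel_epi (λ_ X).hom, ← presheafHomElement_unitElement, comp_app]
  erw [presheafHomElement_ePost]
  rw [presheafHomElement_unitElement, Category.assoc]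

/-- The morphism `C[X, Y] ⟶ C[X', Y']` determined by a family of maps
`C(Γ ⊗ X, Y) → C(Γ ⊗ X', Y')` natural in `Γ`. -/
def presheafHomMap {X Y X' Y' : C} (φ : ∀ Γ : C, (Γ ⊗ X ⟶ Y) → (Γ ⊗ X' ⟶ Y'))
    (hφ : ∀ {Γ Δ : C} (h : Δ ⟶ Γ) (f : Γ ⊗ X ⟶ Y), φ Δ (h ▷ X ≫ f) = h ▷ X' ≫ φ Γ f) :
    presheafHom X Y ⟶ presheafHom X' Y' where
  natTrans :=
    { app := fun Γ => ↾fun t =>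
        (presheafHomEquiv X' Y' Γ.unop).symm (φ Γ.unop (presheafHomElement t))
      naturality := by
        intro Γ Δ h
        ext t
        change (presheafHomEquiv X' Y' Δ.unop).symm
            (φ Δ.unop (presheafHomElement ((presheafHom X Y).functor.map h.unop.op t))) =
          (presheafHom X' Y').functor.map h.unop.op
            ((presheafHomEquiv X' Y' Γ.unop).symm (φ Γ.unop (presheafHomElement t)))
        rw [presheafHomElement_map, hφ, presheafHomEquiv_symm_natural] }

@[simp]
lemma presheafHomElement_presheafHomMap {X Y X' Y' : C}
    (φ : ∀ Γ : C, (Γ ⊗ X ⟶ Y) → (Γ ⊗ X' ⟶ Y'))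
    (hφ : ∀ {Γ Δ : C} (h : Δ ⟶ Γ) (f : Γ ⊗ X ⟶ Y), φ Δ (h ▷ X ≫ f) = h ▷ X' ≫ φ Γ f)
    {Γ : C} (t : (presheafHom X Y).functor.obj (op Γ)) :
    presheafHomElement ((presheafHomMap φ hφ).natTrans.app (op Γ) t) =
      φ Γ (presheafHomElement t) :=
  presheafHomElement_symm _

/-! ### The enriched laws tested on elements -/

/-- Pairs of elements detect equality of maps out of a Day convolution, and
`presheafHomElement_eComp` evaluates the composition on each side. With `p`, `q`, `r` extension
morphisms this is the associativity law. -/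
lemma eComp_ext_iff {X Y Z X' W : C} (p : presheafHom X Y ⟶ presheafHom X' Y)
    (q : presheafHom W Z ⟶ presheafHom Y Z) (r : presheafHom X Z ⟶ presheafHom X' Z) :
    (p ⊗ₘ q) ≫ eComp (Cᵒᵖ ⊛⥤ Type u) X' Y Z =
        (presheafHom X Y ◁ q) ≫ eComp (Cᵒᵖ ⊛⥤ Type u) X Y Z ≫ r ↔
      ∀ (Γ Δ : C) (s : (presheafHom X Y).functor.obj (op Γ))
        (t : (presheafHom W Z).functor.obj (op Δ)),
        (β_ Γ Δ).hom ▷ X' ≫ (α_ Δ Γ X').hom ≫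
            Δ ◁ presheafHomElement (p.natTrans.app (op Γ) s) ≫
              presheafHomElement (q.natTrans.app (op Δ) t) =
          presheafHomElement (r.natTrans.app (op (Γ ⊗ Δ)) ((presheafHomEquiv X Z (Γ ⊗ Δ)).symm
            ((β_ Γ Δ).hom ▷ X ≫ (α_ Δ Γ X).hom ≫ Δ ◁ presheafHomElement s ≫
              presheafHomElement (q.natTrans.app (op Δ) t)))) := by
  have hl (Γ Δ : C) (s : (presheafHom X Y).functor.obj (op Γ))
      (t : (presheafHom W Z).functor.obj (op Δ)) :
      presheafHomElement (Γ := Γ ⊗ Δ) (((p ⊗ₘ q) ≫ eComp (Cᵒᵖ ⊛⥤ Type u) X' Y Z).natTrans.app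
        (op Γ ⊗ op Δ) (tmul s t)) = (β_ Γ Δ).hom ▷ X' ≫ (α_ Δ Γ X').hom ≫
            Δ ◁ presheafHomElement (p.natTrans.app (op Γ) s) ≫
              presheafHomElement (q.natTrans.app (op Δ) t) := by
    rw [comp_app, tensorHom_tmul, presheafHomElement_eComp]
  have hr (Γ Δ : C) (s : (presheafHom X Y).functor.obj (op Γ))
      (t : (presheafHom W Z).functor.obj (op Δ)) :
      ((presheafHom X Y ◁ q) ≫ eComp (Cᵒᵖ ⊛⥤ Type u) X Y Z ≫ r).natTrans.app
        (op Γ ⊗ op Δ) (tmul s t) = r.natTrans.app (op (Γ ⊗ Δ)) ((presheafHomEquiv X Z (Γ ⊗ Δ)).symm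
            ((β_ Γ Δ).hom ▷ X ≫ (α_ Δ Γ X).hom ≫ Δ ◁ presheafHomElement s ≫
              presheafHomElement (q.natTrans.app (op Δ) t))) := by
    rw [comp_app, comp_app, whiskerLeft_tmul, ← presheafHomElement_eComp,
      presheafHomEquiv_symm_element]
    rfl
  constructor
  · intro h Γ Δ s t
    rw [← hl, h]
    exact congrArg presheafHomElement (hr Γ Δ s t)
  · intro h
    refine hom_ext_tmul fun Γ Δ s t => presheafHomElement_injective
      (Γ := Γ.unop ⊗ Δ.unop) ?_
    refine (hl Γ.unop Δ.unop s t).trans ((h Γ.unop Δ.unop s t).trans ?_)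
    exact congrArg presheafHomElement (hr Γ.unop Δ.unop s t).symm

lemma eComp_unit_iff {X X' Y : C} (v : 𝟙_ (Cᵒᵖ ⊛⥤ Type u) ⟶ presheafHom X X')
    (q : presheafHom X Y ⟶ presheafHom X' Y) :
    (v ⊗ₘ q) ≫ eComp (Cᵒᵖ ⊛⥤ Type u) X X' Y = (λ_ (presheafHom X Y)).hom ↔
      ∀ (Γ : C) (t : (presheafHom X Y).functor.obj (op Γ)),
        Γ ◁ presheafHomUnderlying v ≫ presheafHomElement (q.natTrans.app (op Γ) t) =
          presheafHomElement t := by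
  -- Splitting off the left unitor reduces the law to `q` followed by precomposition with `v` being
  -- the identity.
  have h : (v ⊗ₘ q) ≫ eComp (Cᵒᵖ ⊛⥤ Type u) X X' Y =
      (λ_ (presheafHom X Y)).hom ≫ q ≫ ePre v Y := by
    rw [ePre, ← leftUnitor_naturality_assoc, Iso.hom_inv_id_assoc, tensorHom_def'_assoc]
  rw [h, ← cancel_epi (λ_ (presheafHom X Y)).inv, Iso.inv_hom_id_assoc, Iso.inv_hom_id]
  constructor
  · intro h Γ t
    rw [← presheafHomElement_ePre, ← comp_app, h]
    rfl
  · intro h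
    refine hom_ext_presheafHomElement fun Γ t => ?_
    rw [comp_app, presheafHomElement_ePre, h]
    rfl

lemma comp_ePost_iff {X Y Z X' Z' : C} (p : presheafHom X Y ⟶ presheafHom X' Y)
    (q : presheafHom X Z ⟶ presheafHom Z' Z) (f : 𝟙_ (Cᵒᵖ ⊛⥤ Type u) ⟶ presheafHom X' Z')
    (g : 𝟙_ (Cᵒᵖ ⊛⥤ Type u) ⟶ presheafHom Y Z) :
    p ≫ ePost X' g = ePost X g ≫ q ≫ ePre f Z ↔
      ∀ (Γ : C) (t : (presheafHom X Y).functor.obj (op Γ)),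
        presheafHomElement (p.natTrans.app (op Γ) t) ≫ presheafHomUnderlying g =
          Γ ◁ presheafHomUnderlying f ≫ presheafHomElement (q.natTrans.app (op Γ)
            ((presheafHomEquiv X Z Γ).symm (presheafHomElement t ≫ presheafHomUnderlying g))) := by
  have hr (Γ : C) (t : (presheafHom X Y).functor.obj (op Γ)) :
      presheafHomElement ((ePost X g ≫ q ≫ ePre f Z).natTrans.app (op Γ) t) =
        Γ ◁ presheafHomUnderlying f ≫ presheafHomElement (q.natTrans.app (op Γ)
          ((presheafHomEquiv X Z Γ).symm (presheafHomElement t ≫ presheafHomUnderlying g))) := by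
    rw [comp_app, comp_app, presheafHomElement_ePre, ← presheafHomElement_ePost,
      presheafHomEquiv_symm_element]
  constructor
  · intro h Γ t
    rw [← presheafHomElement_ePost, ← comp_app, h, hr]
  · intro h
    refine hom_ext_presheafHomElement fun Γ t => ?_
    rw [comp_app, presheafHomElement_ePost, h, hr]

/-- Both sides are maps out of the Day unit, so their values at the universal element suffice; the
identity takes the left unitor as its value there. -/
lemma comp_eq_eId_iff {X Y : C} (v : 𝟙_ (Cᵒᵖ ⊛⥤ Type u) ⟶ presheafHom X Y)
    (p : presheafHom X Y ⟶ presheafHom Y Y) :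
    v ≫ p = eId (Cᵒᵖ ⊛⥤ Type u) Y ↔
      presheafHomElement (p.natTrans.app (op (𝟙_ C)) ((presheafHomEquiv X Y (𝟙_ C)).symm
        ((λ_ X).hom ≫ presheafHomUnderlying v))) = (λ_ Y).hom := by
  rw [← presheafHomElement_unitElement, presheafHomEquiv_symm_element, ← presheafHomElement_eId]
  exact ⟨fun h => h ▸ rfl, fun h => hom_ext_unit (presheafHomElement_injective h)⟩

end PresheafHom

/-- Strict equality of functors compares morphisms between monads that are only propositionally
equal. This reduces the comparison to the underlying families. -/
lemma EnrichedRelativeMonad.hom_heq {V : Type*} [Category V] [MonoidalCategory V] {A D : Type*}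
    [EnrichedCategory V D] {J : A → D} {M M' N N' : EnrichedRelativeMonad V J}
    (hM : M = M') (hN : N = N') {γ : M ⟶ N} {γ' : M' ⟶ N'}
    (h : HEq (Hom.app γ) (Hom.app γ')) : HEq γ γ' := by
  subst hM hN
  exact heq_of_eq (Hom.ext (eq_of_heq h))

lemma StrongRelativeMonad.hom_heq {A C : Type*} [Category C] [MonoidalCategory C] {J : A → C}
    {M M' N N' : StrongRelativeMonad J} (hM : M = M') (hN : N = N') {γ : M ⟶ N} {γ' : M' ⟶ N'}
    (h : HEq (Hom.app γ) (Hom.app γ')) : HEq γ γ' := by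
  subst hM hN
  exact heq_of_eq (Hom.ext (eq_of_heq h))

/-! ### Translating monads and their morphisms -/

section RelativeMonads

open DayPresheaf

variable {C : Type u} [SmallCategory C] [MonoidalCategory C] [SymmetricCategory C] {A : Type w}
  {J : A → C}

namespace EnrichedRelativeMonad

/-- The extension operator of an enriched relative monad, under the Yoneda bijections. -/
def strongExt (M : EnrichedRelativeMonad (Cᵒᵖ ⊛⥤ Type u) J) {Γ : C} {a b : A}
    (f : Γ ⊗ J a ⟶ M.obj b) : Γ ⊗ M.obj a ⟶ M.obj b :=
  presheafHomElement ((M.ext a b).natTrans.app (op Γ) ((presheafHomEquiv _ _ Γ).symm f))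

lemma presheafHomElement_ext (M : EnrichedRelativeMonad (Cᵒᵖ ⊛⥤ Type u) J) {Γ : C} {a b : A}
    (t : (presheafHom (J a) (M.obj b)).functor.obj (op Γ)) :
    presheafHomElement ((M.ext a b).natTrans.app (op Γ) t) = M.strongExt (presheafHomElement t) := by
  rw [strongExt, presheafHomEquiv_symm_element]

lemma strongExt_natural (M : EnrichedRelativeMonad (Cᵒᵖ ⊛⥤ Type u) J) {Γ Δ : C} {a b : A}
    (h : Δ ⟶ Γ) (f : Γ ⊗ J a ⟶ M.obj b) :
    M.strongExt (h ▷ J a ≫ f) = h ▷ M.obj a ≫ M.strongExt f := by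
  rw [strongExt, presheafHomEquiv_symm_natural, app_map]
  exact presheafHomElement_map _ _

/-- The strong relative monad underlying an enriched one. -/
def toStrong (M : EnrichedRelativeMonad (Cᵒᵖ ⊛⥤ Type u) J) : StrongRelativeMonad J where
  obj := M.obj
  unit a := presheafHomUnderlying (M.unit a)
  ext f := M.strongExt f
  ext_natural h f := M.strongExt_natural h f
  unit_ext a := (comp_eq_eId_iff _ _).1 (M.unit_ext a)
  unit_comp_ext {Γ a b} f := by
    have h := (eComp_unit_iff _ _).1 (M.unit_comp_ext a b) Γ ((presheafHomEquiv _ _ Γ).symm f)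
    rwa [presheafHomElement_symm] at h
  ext_comp_ext {Γ Δ a b c} f g := by
    have h := (eComp_ext_iff _ _ _).1 (M.ext_comp_ext a b c) Γ Δ
      ((presheafHomEquiv _ _ Γ).symm f) ((presheafHomEquiv _ _ Δ).symm g)
    rw [presheafHomElement_symm] at h
    -- Both sides of the enriched law carry the invertible braiding of `Γ` with `Δ`: naturality
    -- takes it out of the extension, and it cancels.
    exact (cancel_epi _).1 (h.trans (M.strongExt_natural _ _))

lemma isUnderlying_toStrong (M : EnrichedRelativeMonad (Cᵒᵖ ⊛⥤ Type u) J) :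
    StrongRelativeMonad.IsUnderlying M M.toStrong where
  obj_eq _ := rfl
  unit_eq a := Category.comp_id (presheafHomUnderlying (M.unit a))
  ext_eq Γ a b t := by
    change M.strongExt (presheafHomElement t ≫ 𝟙 (M.obj b)) ≫ 𝟙 (M.obj b) = Γ ◁ 𝟙 (M.obj a) ≫ _
    rw [Category.comp_id, Category.comp_id, MonoidalCategory.whiskerLeft_id, Category.id_comp,
      presheafHomElement_ext]

end EnrichedRelativeMonad

namespace StrongRelativeMonad

/-- The extension morphisms determined by the extension operators of a strong relative monad. -/
def enrichedExt (N : StrongRelativeMonad J) (a b : A) :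
    presheafHom (J a) (N.obj b) ⟶ presheafHom (N.obj a) (N.obj b) :=
  presheafHomMap (fun _ f => N.ext f) N.ext_natural

lemma presheafHomElement_enrichedExt (N : StrongRelativeMonad J) {a b : A} {Γ : C}
    (t : (presheafHom (J a) (N.obj b)).functor.obj (op Γ)) :
    presheafHomElement ((N.enrichedExt a b).natTrans.app (op Γ) t) = N.ext (presheafHomElement t) :=
  presheafHomElement_presheafHomMap _ _ t

/-- The enriched relative monad determined by a strong one. -/
def toEnriched (N : StrongRelativeMonad J) : EnrichedRelativeMonad (Cᵒᵖ ⊛⥤ Type u) J where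
  obj := N.obj
  unit a := (presheafHomUnderlyingEquiv _ _).symm (N.unit a)
  ext a b := N.enrichedExt a b
  unit_ext a := (comp_eq_eId_iff _ _).2 <| by
    rw [presheafHomElement_enrichedExt, presheafHomElement_symm, presheafHomUnderlying_symm,
      N.unit_ext]
  unit_comp_ext a b := (eComp_unit_iff _ _).2 fun Γ t => by
    rw [presheafHomElement_enrichedExt, presheafHomUnderlying_symm, N.unit_comp_ext]
  ext_comp_ext a b c := (eComp_ext_iff _ _ _).2 fun Γ Δ s t => by
    simp only [presheafHomElement_enrichedExt, presheafHomElement_symm]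
    -- Naturality along the braiding moves it out of the extension, to match the enriched side.
    rw [N.ext_comp_ext, N.ext_natural]

end StrongRelativeMonad

/-! ### The two functors and their strict inverseness -/

/-- The functor from enriched relative monads to strong relative monads. -/
def enrichedToStrong (J : A → C) :
    EnrichedRelativeMonad (Cᵒᵖ ⊛⥤ Type u) J ⥤ StrongRelativeMonad J where
  obj M := M.toStrong
  map {M N} γ :=
    { app a := presheafHomUnderlying (EnrichedRelativeMonad.Hom.app γ a)
      unit_app a := (presheafHomUnderlying_comp_ePost _ _).symm.trans
        (congrArg _ (EnrichedRelativeMonad.Hom.unit_app γ a))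
      ext_app {Γ a b} (f : Γ ⊗ J a ⟶ M.obj b) := by
        have h := (comp_ePost_iff _ _ _ _).1 (EnrichedRelativeMonad.Hom.ext_app γ a b) Γ
          ((presheafHomEquiv _ _ Γ).symm f)
        rw [presheafHomElement_symm] at h
        exact h }
  map_id M := StrongRelativeMonad.Hom.ext (funext fun a => presheafHomUnderlying_eId _)
  map_comp f g := StrongRelativeMonad.Hom.ext (funext fun a => presheafHomUnderlying_comp_ePost _ _)

/-- The functor from strong relative monads to enriched relative monads. -/
def strongToEnriched (J : A → C) :
    StrongRelativeMonad J ⥤ EnrichedRelativeMonad (Cᵒᵖ ⊛⥤ Type u) J where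
  obj N := N.toEnriched
  map {M N} γ :=
    { app a := (presheafHomUnderlyingEquiv (M.obj a) (N.obj a)).symm
        (StrongRelativeMonad.Hom.app γ a)
      unit_app a := presheafHomUnderlying_injective <|
        (presheafHomUnderlying_comp_ePost _ _).trans <|
          (congrArg₂ (· ≫ ·) (presheafHomUnderlying_symm _) (presheafHomUnderlying_symm _)).trans <|
            (StrongRelativeMonad.Hom.unit_app γ a).trans (presheafHomUnderlying_symm _).symm
      ext_app a b := (comp_ePost_iff (M.enrichedExt a b) (N.enrichedExt a b) _ _).2 fun Γ t => by
        rw [M.presheafHomElement_enrichedExt, N.presheafHomElement_enrichedExt,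
          presheafHomElement_symm, presheafHomUnderlying_symm, presheafHomUnderlying_symm]
        exact StrongRelativeMonad.Hom.ext_app γ (presheafHomElement t) }
  map_id M := EnrichedRelativeMonad.Hom.ext <| funext fun a => presheafHomUnderlying_injective <|
    (presheafHomUnderlying_symm _).trans (presheafHomUnderlying_eId _).symm
  map_comp f g := EnrichedRelativeMonad.Hom.ext <| funext fun a => presheafHomUnderlying_injective <|
    (presheafHomUnderlying_symm _).trans <|
      (congrArg₂ (· ≫ ·) (presheafHomUnderlying_symm _) (presheafHomUnderlying_symm _)).symm.trans
        (presheafHomUnderlying_comp_ePost _ _).symm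

lemma toEnriched_toStrong (M : EnrichedRelativeMonad (Cᵒᵖ ⊛⥤ Type u) J) :
    M.toStrong.toEnriched = M := by
  -- The round trip returns the objects `T a` definitionally, so units and extensions can be
  -- compared by plain equality; the laws are propositions.
  have h₁ : M.toStrong.toEnriched.unit = M.unit := funext fun a =>
    (presheafHomUnderlyingEquiv _ _).symm_apply_apply (M.unit a)
  have h₂ : M.toStrong.toEnriched.ext = M.ext := funext fun a => funext fun b =>
    hom_ext_presheafHomElement fun Γ t =>
      (presheafHomElement_presheafHomMap _ _ t).trans (M.presheafHomElement_ext t).symm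
  cases M
  simp only [StrongRelativeMonad.toEnriched] at h₁ h₂ ⊢
  congr

lemma toStrong_toEnriched (N : StrongRelativeMonad J) : N.toEnriched.toStrong = N := by
  have h₁ : N.toEnriched.toStrong.unit = N.unit := funext fun a => presheafHomUnderlying_symm _
  have h₂ : @StrongRelativeMonad.ext _ _ _ _ _ N.toEnriched.toStrong = @N.ext := by
    funext Γ a b f
    exact (presheafHomElement_presheafHomMap _ _ _).trans (congrArg _ (presheafHomElement_symm f))
  cases N
  simp only [EnrichedRelativeMonad.toStrong] at h₁ h₂ ⊢
  congr

/-- The isomorphism between the categories of enriched and of strong relative monads. -/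
def enrichedIsoStrong (J : A → C) :
    Cat.of (EnrichedRelativeMonad (Cᵒᵖ ⊛⥤ Type u) J) ≅ Cat.of (StrongRelativeMonad J) where
  hom := (enrichedToStrong J).toCatHom
  inv := (strongToEnriched J).toCatHom
  hom_inv_id := congrArg Functor.toCatHom <|
    Functor.hext (F := enrichedToStrong J ⋙ strongToEnriched J) (G := 𝟭 _)
      toEnriched_toStrong fun M N _ =>
        EnrichedRelativeMonad.hom_heq (toEnriched_toStrong M) (toEnriched_toStrong N) <|
          heq_of_eq <| funext fun _ => (presheafHomUnderlyingEquiv _ _).symm_apply_apply _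
  inv_hom_id := congrArg Functor.toCatHom <|
    Functor.hext (F := strongToEnriched J ⋙ enrichedToStrong J) (G := 𝟭 _)
      toStrong_toEnriched fun M N _ =>
        StrongRelativeMonad.hom_heq (toStrong_toEnriched M) (toStrong_toEnriched N) <|
          heq_of_eq <| funext fun _ => presheafHomUnderlying_symm _

end RelativeMonads

end

theorem mainTheorem1 {C : Type u} [SmallCategory C] [MonoidalCategory C] [SymmetricCategory C]
    {A : Type w} (J : A → C) :
    ∃ e : Cat.of (EnrichedRelativeMonad (Cᵒᵖ ⊛⥤ Type u) J) ≅ Cat.of (StrongRelativeMonad J),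
      ∃ h : ∀ M : EnrichedRelativeMonad (Cᵒᵖ ⊛⥤ Type u) J,
        StrongRelativeMonad.IsUnderlying M (e.hom.toFunctor.obj M),
      ∀ (M N : EnrichedRelativeMonad (Cᵒᵖ ⊛⥤ Type u) J) (γ : M ⟶ N) (a : A),
        StrongRelativeMonad.Hom.app (e.hom.toFunctor.map γ) a ≫ eqToHom ((h N).obj_eq a) =
          eqToHom ((h M).obj_eq a) ≫
            presheafHomUnderlying (EnrichedRelativeMonad.Hom.app γ a) := by
  refine ⟨enrichedIsoStrong J, fun M => M.isUnderlying_toStrong, fun M N γ a => ?_⟩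
  -- The functor keeps objects definitionally, so both `eqToHom`s are identities.
  exact (Category.comp_id _).trans (Category.id_comp _).symm
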